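/- Let $k$ be a field, let $0\le r\le n$ be integers and let $R=k[x_0,\dots,x_n]$. Let $P_0,\dots,P_r$ be points of $\mathbb P^n=\mathbb P^n(k)$ in general position, that is, vectors of $k^{n+1}$ representing them are linearly independent, and let $a_0,\dots,a_r$ be non-negative integers. For each $i$ let $\mathfrak p_i\subset R$ be the ideal generated by all homogeneous polynomials that vanish at $P_i$, and let $$I=\mathfrak p_0^{a_0}\cap\cdots\cap\mathfrak p_r^{a_r}$$ be the ideal of the fat points $(P_0,a_0),\dots,(P_r,a_r)$. Then $I$ is componentwise linear. That is, $I$ is a homogeneous ideal and, for every integer $d\ge 0$, the ideal $I_{<d>}$ generated by all homogeneous elements of degree $d$ in $I$ has a $d$-linear resolution: there is an exact sequence of graded $R$-modules and degree-preserving homomorphisms $$\cdots\to R(-d-2)^{b_2}\to R(-d-1)^{b_1}\to R(-d)^{b_0}\to I_{<d>}\to 0$$ with integers $b_i\ge 0$. In particular, this holds when $P_i=[0:\cdots:0:1:0:\cdots:0]$ with the $1$ in position $i$, in which case $\mathfrak p_i=(x_0,\dots,x_{i-1},x_{i+1},\dots,x_n)$. -/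

import Mathlib

namespace FatPoint

open MvPolynomial

attribute [local instance] MvPolynomial.gradedAlgebra

/-- The homogeneous ideal `𝔭_P` of a point `P` of projective `n`-space over `k`: the ideal of
`k[x_0, …, x_n]` generated by the homogeneous polynomials (forms) that vanish at `P`, i.e. on the
line of `k^(n+1)` that `P` stands for. (It is essential over a finite field to use forms only.) -/
noncomputable def pointIdeal {k : Type*} [Field k] {n : ℕ} (P : Projectivization k (Fin (n + 1) → k)) :
    Ideal (MvPolynomial (Fin (n + 1)) k) :=
  Ideal.span {f | ∃ d : ℕ, f.IsHomogeneous d ∧ ∀ v ∈ P.submodule, eval v f = 0}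

/-- The ideal `𝔭_{P_0}^{a_0} ∩ ⋯ ∩ 𝔭_{P_r}^{a_r}` of the fat points
`(P_0, a_0), …, (P_r, a_r)`. -/
noncomputable def fatPointIdeal {k : Type*} [Field k] {n r : ℕ}
    (P : Fin (r + 1) → Projectivization k (Fin (n + 1) → k)) (a : Fin (r + 1) → ℕ) :
    Ideal (MvPolynomial (Fin (n + 1)) k) :=
  ⨅ i, pointIdeal (P i) ^ a i

/-- `J_{<d>}`: the ideal generated by all homogeneous elements of degree `d` in `J`. -/
noncomputable def degreePart {k : Type*} [Field k] {n : ℕ} (J : Ideal (MvPolynomial (Fin (n + 1)) k)) (d : ℕ) :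
    Ideal (MvPolynomial (Fin (n + 1)) k) :=
  Ideal.span {f | f ∈ J ∧ f.IsHomogeneous d}

/-- `J` has a `d`-linear resolution: with `R = k[x_0, …, x_n]` there is an exact sequence
`⋯ → R(-d-2)^{b_2} → R(-d-1)^{b_1} → R(-d)^{b_0} → J → 0` of graded `R`-modules and
degree-preserving maps. The map onto `J` is given by forms `gen l` of degree `d` which generate
`J`, and the map `R(-d-i-1)^{b_{i+1}} → R(-d-i)^{b_i}` by a matrix `M i` of linear forms
(zero entries are allowed). As the entries of the matrices lie in the ideal `(x_0, …, x_n)`, such a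
free resolution is automatically the minimal one. The zero ideal is resolved by `b = 0`. -/
def HasLinearResolution {k : Type*} [Field k] {n : ℕ}
    (J : Ideal (MvPolynomial (Fin (n + 1)) k)) (d : ℕ) : Prop :=
  ∃ (b : ℕ → ℕ) (gen : Fin (b 0) → MvPolynomial (Fin (n + 1)) k)
    (M : ∀ i : ℕ, Matrix (Fin (b i)) (Fin (b (i + 1))) (MvPolynomial (Fin (n + 1)) k)),
    (∀ l, (gen l).IsHomogeneous d) ∧
    (∀ i l m, (M i l m).IsHomogeneous 1) ∧
    Ideal.span (Set.range gen) = J ∧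
    Function.Exact (M 0).mulVecLin
      (Fintype.linearCombination (MvPolynomial (Fin (n + 1)) k) gen) ∧
    ∀ i, Function.Exact (M (i + 1)).mulVecLin (M i).mulVecLin

/-- A componentwise linear ideal: a homogeneous ideal `J` such that for every `d` the ideal
`J_{<d>}` has a `d`-linear resolution. -/
def IsComponentwiseLinear {k : Type*} [Field k] {n : ℕ}
    (J : Ideal (MvPolynomial (Fin (n + 1)) k)) : Prop :=
  J.IsHomogeneous (homogeneousSubmodule (Fin (n + 1)) k) ∧
    ∀ d : ℕ, HasLinearResolution (degreePart J d) d

end FatPoint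

namespace FatPoint

open MvPolynomial

attribute [local instance] MvPolynomial.gradedAlgebra

/-! ### Linear quotients and their syzygies -/

section LinearQuotients

variable {k σ τ : Type*} [Field k]

/-! Independent points become coordinate points after a linear change of variables. A power of the
prime of a coordinate point is spanned by the monomials with enough degree in the other variables,
so the degree `d` piece of the ideal is spanned by the monomials of degree `d` with upper bounds on
some exponents. Such sets satisfy the polymatroid exchange property, hence have linear quotients
(`exists_linearQuotients_monomial`).

Linear quotients yield a linear resolution by iteration: if the colon ideals are generated by
members of a regular family of linear forms, the syzygies are generated by linear ones which have
linear quotients over the same family (`LinearQuotients.exists_syzygies`). -/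

theorem exists_sum_smul_of_mem_span_image {R N ι : Type*} [CommRing R] [AddCommGroup N] [Module R N]
    [Fintype ι] {g : ι → N} {A : Set ι} {y : N} (hy : y ∈ Submodule.span R (g '' A)) :
    ∃ f : ι → R, (∀ t, t ∉ A → f t = 0) ∧ ∑ t, f t • g t = y := by
  obtain ⟨l, hl, rfl⟩ := (Finsupp.mem_span_image_iff_linearCombination R).1 hy
  refine ⟨l, fun t ht => Finsupp.notMem_support_iff.1 fun h => ht (hl h), ?_⟩
  rw [Finsupp.linearCombination_apply, Finsupp.sum_fintype _ _ (by simp)]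

theorem homogeneousComponent_succ_mul {p q : MvPolynomial σ k} {m d : ℕ} (hq : q.IsHomogeneous d) :
    homogeneousComponent (m + d) (p * q) = homogeneousComponent m p * q := by
  classical
  conv_lhs => rw [← sum_homogeneousComponent p, Finset.sum_mul, map_sum]
  have key : ∀ i, homogeneousComponent (m + d) (homogeneousComponent i p * q) =
      if i = m then homogeneousComponent m p * q else 0 := fun i => by
    rw [homogeneousComponent_of_mem
      ((homogeneousComponent_isHomogeneous i p).mul hq : _ ∈ homogeneousSubmodule σ k (i + d))]
    by_cases h : i = m
    · simp [h]
    · rw [if_neg h, if_neg (by omega)]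
  rw [Finset.sum_congr rfl fun i _ => key i, Finset.sum_ite_eq']
  split_ifs with h
  · rfl
  · rw [homogeneousComponent_eq_zero, zero_mul]
    simpa using h

/-- The family `g` has linear quotients with respect to the linear forms `L`: each colon ideal
`⟨g l, l < i⟩ : g i` is generated by the `L j` with `j ∈ S i`, and the relations which witness this
can be chosen to have linear coefficients. -/
structure LinearQuotients {N ι : Type*} [AddCommGroup N] [Module (MvPolynomial σ k) N] [Fintype ι]
    [LinearOrder ι] (L : τ → MvPolynomial σ k) (g : ι → N) (S : ι → Finset τ) : Prop where
  colon_le : ∀ i f, f • g i ∈ Submodule.span (MvPolynomial σ k) (g '' Set.Iio i) →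
    f ∈ Ideal.span (L '' (S i : Set τ))
  exists_coeff : ∀ i, ∀ j ∈ S i, ∃ c : ι → MvPolynomial σ k, (∀ l, (c l).IsHomogeneous 1) ∧
    (∀ l, i ≤ l → c l = 0) ∧ L j • g i = ∑ l, c l • g l

theorem LinearQuotients.comp_orderIso {N ι κ : Type*} [AddCommGroup N]
    [Module (MvPolynomial σ k) N] [Fintype ι] [LinearOrder ι] [Fintype κ] [LinearOrder κ]
    {L : τ → MvPolynomial σ k} {g : ι → N} {S : ι → Finset τ} (h : LinearQuotients L g S)
    (e : κ ≃o ι) : LinearQuotients L (g ∘ e) (S ∘ e) where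
  colon_le i f hf := by
    refine h.colon_le (e i) f ?_
    rwa [Set.image_comp, e.image_Iio] at hf
  exists_coeff i j hj := by
    obtain ⟨c, hc, hc0, hsum⟩ := h.exists_coeff (e i) j hj
    refine ⟨c ∘ e, fun l => hc _, fun l hl => hc0 _ (e.monotone hl), ?_⟩
    exact hsum.trans (Equiv.sum_comp e.toEquiv fun l => c l • g l).symm

/-- Linear forms each of which is a nonzerodivisor modulo any set of others. -/
def IsRegularFamily (L : τ → MvPolynomial σ k) : Prop :=
  ∀ (A : Set τ) (j : τ) (f : MvPolynomial σ k), j ∉ A → f * L j ∈ Ideal.span (L '' A) →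
    f ∈ Ideal.span (L '' A)

/-- The kernel of the map given by a family with linear quotients is generated by a family of
linear syzygies which again has linear quotients. -/
theorem LinearQuotients.exists_syzygies [Fintype τ] [LinearOrder τ] {N : Type*} [AddCommGroup N]
    [Module (MvPolynomial σ k) N] {b : ℕ} {L : τ → MvPolynomial σ k} {g : Fin b → N}
    {S : Fin b → Finset τ} (h : LinearQuotients L g S) (hL : ∀ j, (L j).IsHomogeneous 1)
    (hreg : IsRegularFamily L) :
    ∃ (b' : ℕ) (g' : Fin b' → Fin b → MvPolynomial σ k) (S' : Fin b' → Finset τ),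
      LinearQuotients L g' S' ∧ (∀ t l, (g' t l).IsHomogeneous 1) ∧
      Submodule.span (MvPolynomial σ k) (Set.range g') =
        LinearMap.ker (Fintype.linearCombination (MvPolynomial σ k) g) := by
  classical
  let R := MvPolynomial σ k
  -- One syzygy per generator `i` and colon form `L j`, ordered first by `i`, then by `j`.
  let T := {t : Fin b ×ₗ τ // (ofLex t).2 ∈ S (ofLex t).1}
  let fst : T → Fin b := fun t => (ofLex t.1).1
  let snd : T → τ := fun t => (ofLex t.1).2
  let mk : ∀ i j, j ∈ S i → T := fun i j hj => ⟨toLex (i, j), hj⟩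
  have : Finite (Fin b ×ₗ τ) := inferInstanceAs (Finite (Fin b × τ))
  have : Fintype T := Fintype.ofFinite T
  choose c hc1 hc0 hcs using fun t : T => h.exists_coeff (fst t) (snd t) t.2
  let s : T → Fin b → R := fun t => Pi.single (fst t) (L (snd t)) - c t
  have hs1 : ∀ t l, (s t l).IsHomogeneous 1 := by
    intro t l
    refine IsHomogeneous.sub ?_ (hc1 t l)
    by_cases hl : l = fst t
    · subst hl; simpa using hL _
    · simpa [hl] using isHomogeneous_zero σ k 1
  have hsker : ∀ t, Fintype.linearCombination R g (s t) = 0 := by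
    intro t
    simp only [s]
    rw [map_sub, Fintype.linearCombination_apply_single, sub_eq_zero,
      Fintype.linearCombination_apply]
    exact hcs t
  have hsgt : ∀ t l, fst t < l → s t l = 0 := by
    intro t l hl
    simp [s, hl.ne', hc0 t l hl.le]
  have hsself : ∀ t, s t (fst t) = L (snd t) := by
    intro t
    simp [s, hc0 t _ le_rfl]
  -- A syzygy supported on the first `p` generators comes from the syzygies `s t` with `fst t < p`.
  have hgen : ∀ p : ℕ, ∀ y : Fin b → R, Fintype.linearCombination R g y = 0 →
      (∀ l : Fin b, p ≤ l.val → y l = 0) →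
      y ∈ Submodule.span R (s '' {t | (fst t).val < p}) := by
    intro p
    induction p with
    | zero =>
      intro y _ hy
      rw [show y = 0 from funext fun l => hy l (Nat.zero_le _)]
      exact Submodule.zero_mem _
    | succ p ih =>
      intro y hy hy0
      have hmono : Submodule.span R (s '' {t | (fst t).val < p}) ≤
          Submodule.span R (s '' {t | (fst t).val < p + 1}) :=
        Submodule.span_mono (Set.image_mono fun t (ht : _ < _) => Nat.lt_succ_of_lt ht)
      by_cases hp : p < b
      · let i : Fin b := ⟨p, hp⟩
        have hmem : y i ∈ Ideal.span (L '' (S i : Set τ)) := by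
          refine h.colon_le i _ ?_
          rw [Fintype.linearCombination_apply, ← Finset.add_sum_erase _ _ (Finset.mem_univ i),
            add_eq_zero_iff_eq_neg] at hy
          rw [hy]
          refine Submodule.neg_mem _ (Submodule.sum_mem _ fun l hl => ?_)
          rcases lt_trichotomy l i with hli | hli | hli
          · exact Submodule.smul_mem _ _ (Submodule.subset_span ⟨l, hli, rfl⟩)
          · exact absurd hli (Finset.ne_of_mem_erase hl)
          · rw [hy0 l (Nat.succ_le_of_lt hli), zero_smul]
            exact Submodule.zero_mem _
        obtain ⟨f, hf0, hf⟩ := exists_sum_smul_of_mem_span_image hmem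
        let z : Fin b → R := ∑ j : S i, f j • s (mk i j j.2)
        have hz : z ∈ Submodule.span R (s '' {t | (fst t).val < p + 1}) :=
          Submodule.sum_mem _ fun j _ => Submodule.smul_mem _ _
            (Submodule.subset_span ⟨mk i j j.2, Nat.lt_succ_self p, rfl⟩)
        have hzi : z i = y i := by
          rw [← hf, ← Finset.sum_subset (Finset.subset_univ (S i))
            (fun t _ ht => by rw [hf0 t (by simpa using ht), zero_smul]), ← Finset.sum_coe_sort]
          simp only [z, Finset.sum_apply, Pi.smul_apply]
          refine Finset.sum_congr rfl fun j _ => ?_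
          rw [show s (mk i j j.2) i = L j from hsself (mk i j j.2)]
        have hzgt : ∀ l, i < l → z l = 0 := by
          intro l hl
          simp only [z, Finset.sum_apply, Pi.smul_apply]
          refine Finset.sum_eq_zero fun j _ => ?_
          rw [hsgt (mk i j j.2) l hl, smul_zero]
        rw [← sub_add_cancel y z]
        refine Submodule.add_mem _ (hmono (ih (y - z) ?_ fun l hl => ?_)) hz
        · simp only [z]
          rw [map_sub, hy, map_sum, Finset.sum_eq_zero, sub_zero]
          intro j _
          rw [map_smul, hsker, smul_zero]
        · rcases hl.eq_or_lt with hl' | hl'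
          · have : l = i := Fin.ext hl'.symm
            rw [this, Pi.sub_apply, hzi, sub_self]
          · rw [Pi.sub_apply, hy0 l hl', hzgt l hl', sub_zero]
      · exact hmono (ih y hy fun l hl => absurd l.2 (by omega))
  have hspan : Submodule.span R (Set.range s) =
      LinearMap.ker (Fintype.linearCombination R g) := by
    apply le_antisymm
    · rw [Submodule.span_le]
      rintro _ ⟨t, rfl⟩
      exact hsker t
    · intro y hy
      exact Submodule.span_mono (Set.image_subset_range _ _)
        (hgen b y hy fun l hl => absurd l.2 (by omega))
  have hlin : LinearQuotients L s
      (fun t => (S (fst t)).filter (· < snd t)) := by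
    refine ⟨fun t f hf => ?_, fun t j' hj' => ?_⟩
    -- In coordinate `fst t`, earlier syzygies contribute `0` or, for equal first index, a smaller
    -- `L j`; regularity then cancels `L (snd t)`.
    · have h1 : f * L (snd t) ∈ Ideal.span (L '' {j | j ∈ S (fst t) ∧ j < snd t}) := by
        have h2 := Submodule.mem_map_of_mem (f := LinearMap.proj (R := R) (φ := fun _ => R) (fst t)) hf
        rw [map_smul, LinearMap.proj_apply, hsself] at h2
        rw [Submodule.map_span] at h2
        refine Submodule.span_le.2 ?_ h2
        rintro _ ⟨_, ⟨t', ht', rfl⟩, rfl⟩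
        rcases (Prod.Lex.lt_iff (x := t'.1) (y := t.1)).1 ht' with hlt | ⟨heq, hlt⟩
        · simp only [LinearMap.proj_apply]
          rw [hsgt t' _ hlt]
          exact Submodule.zero_mem _
        · have heq' : fst t' = fst t := heq
          simp only [LinearMap.proj_apply]
          rw [← heq', hsself]
          exact Ideal.subset_span ⟨snd t', ⟨t'.2, hlt⟩, rfl⟩
      have h3 := hreg _ _ f (fun hmem => lt_irrefl _ hmem.2) h1
      simpa [Finset.coe_filter] using h3
    · obtain ⟨hj'S, hj'lt⟩ := Finset.mem_filter.1 hj'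
      let t' : T := mk (fst t) j' hj'S
      -- The Koszul combination cancels the leading entries, so `y` is generated by syzygies of
      -- smaller first index.
      let y : Fin b → R := L j' • s t - L (snd t) • s t'
      have hy : Fintype.linearCombination R g y = 0 := by
        simp only [y]
        rw [map_sub, map_smul, map_smul, hsker, hsker, smul_zero, smul_zero, sub_zero]
      have hy2 : ∀ l, (y l).IsHomogeneous (1 + 1) := fun l =>
        ((hL _).mul (hs1 _ _)).sub ((hL _).mul (hs1 _ _))
      have hy0 : ∀ l : Fin b, (fst t).val ≤ l.val → y l = 0 := by
        intro l hl
        rcases hl.eq_or_lt with hl' | hl'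
        · obtain rfl : fst t = l := Fin.ext hl'
          have h1 : s t' (fst t) = L j' := hsself t'
          simp only [y, Pi.sub_apply, Pi.smul_apply, smul_eq_mul, hsself, h1]
          ring
        · simp only [y, Pi.sub_apply, Pi.smul_apply]
          rw [hsgt t l hl', hsgt t' l hl', smul_zero, smul_zero, sub_zero]
      obtain ⟨f, hf0, hf⟩ := exists_sum_smul_of_mem_span_image (hgen _ y hy hy0)
      have ht't : t' < t := (Prod.Lex.lt_iff (x := t'.1) (y := t.1)).2 (Or.inr ⟨rfl, hj'lt⟩)
      -- Since `y` is quadratic and each `s u` linear, only the linear parts of the coefficients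
      -- matter.
      refine ⟨Pi.single t' (L (snd t)) + fun u => homogeneousComponent 1 (f u), fun u => ?_,
        fun u hu => ?_, ?_⟩
      · refine IsHomogeneous.add ?_ (homogeneousComponent_isHomogeneous _ _)
        by_cases hl : u = t'
        · subst hl; simpa using hL _
        · simpa [hl] using isHomogeneous_zero σ k 1
      · have h1 : f u = 0 := hf0 u fun hlt => by
          refine absurd hu (not_le.2 ?_)
          exact (Prod.Lex.lt_iff (x := u.1) (y := t.1)).2 (Or.inl hlt)
        simp [h1, (ht't.trans_le hu).ne']
      · have h1 : ∑ u, homogeneousComponent 1 (f u) • s u = y := by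
          funext l
          rw [← homogeneousComponent_eq_self (hy2 l), ← hf]
          simp only [Finset.sum_apply, Pi.smul_apply, smul_eq_mul, map_sum]
          exact Finset.sum_congr rfl fun u _ => (homogeneousComponent_succ_mul (hs1 u l)).symm
        simp only [Pi.add_apply, add_smul, Finset.sum_add_distrib, h1]
        rw [Finset.sum_eq_single t' (fun u _ hu => by rw [Pi.single_eq_of_ne hu, zero_smul])
          (fun hu => absurd (Finset.mem_univ _) hu), Pi.single_eq_same]
        simp [y]
  let e := Fintype.orderIsoFinOfCardEq T rfl
  refine ⟨Fintype.card T, s ∘ e, _, hlin.comp_orderIso e, fun t l => hs1 _ _, ?_⟩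
  rw [e.surjective.range_comp, hspan]

end LinearQuotients

/-! ### From linear quotients to a linear resolution -/

section Resolution

variable {k : Type*} [Field k] {n : ℕ}

/-- A matrix, given by its columns, whose columns are linear and have linear quotients. -/
structure LinearStage (L : Fin (n + 1) → MvPolynomial (Fin (n + 1)) k) where
  rows : ℕ
  cols : ℕ
  col : Fin cols → Fin rows → MvPolynomial (Fin (n + 1)) k
  colon : Fin cols → Finset (Fin (n + 1))
  linearQuotients : LinearQuotients L col colon
  isHomogeneous : ∀ t l, (col t l).IsHomogeneous 1

theorem mulVecLin_eq_linearCombination {R : Type*} [CommRing R] {a b : ℕ} (g : Fin b → Fin a → R) :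
    (Matrix.of fun l m => g m l).mulVecLin = Fintype.linearCombination R g := by
  ext v l
  simp [Matrix.mulVec, dotProduct, Fintype.linearCombination_apply, Finset.sum_apply, mul_comm]

theorem LinearQuotients.hasLinearResolution {L : Fin (n + 1) → MvPolynomial (Fin (n + 1)) k}
    (hL : ∀ j, (L j).IsHomogeneous 1) (hreg : IsRegularFamily L) {b d : ℕ}
    {g : Fin b → MvPolynomial (Fin (n + 1)) k} {S : Fin b → Finset (Fin (n + 1))}
    (h : LinearQuotients L g S) (hg : ∀ l, (g l).IsHomogeneous d) :
    HasLinearResolution (Ideal.span (Set.range g)) d := by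
  obtain ⟨c₀, g₀, S₀, h₀, hg₀, hker₀⟩ := h.exists_syzygies hL hreg
  choose c g' S' h1 h2 h3 using fun s : LinearStage L => s.linearQuotients.exists_syzygies hL hreg
  -- The columns of each stage generate the syzygies of the previous columns. Its row count is the
  -- previous column count by definition, so consecutive matrices compose.
  let seq : ℕ → LinearStage L := fun i => Nat.rec (motive := fun _ => LinearStage L)
    ⟨b, c₀, g₀, S₀, h₀, hg₀⟩ (fun _ s => ⟨s.cols, c s, g' s, S' s, h1 s, h2 s⟩) i
  refine ⟨fun i => (seq i).rows, g, fun i => Matrix.of fun l m => (seq i).col m l, hg,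
    fun i l m => (seq i).isHomogeneous m l, rfl, ?_, fun i => ?_⟩
  · rw [LinearMap.exact_iff, Matrix.range_mulVecLin]
    exact hker₀.symm
  · rw [LinearMap.exact_iff, Matrix.range_mulVecLin]
    refine (congrArg LinearMap.ker (mulVecLin_eq_linearCombination (seq i).col)).trans ?_
    exact (h3 (seq i)).symm

end Resolution

/-! ### Monomial ideals and the exchange property -/

section Monomial

variable {k : Type*} [Field k]

/-- Membership is tested on each monomial, and multiplication by `X j` leaves the exponents of the
variables in `A` unchanged. -/
theorem isRegularFamily_X {σ : Type*} :
    IsRegularFamily (X : σ → MvPolynomial σ k) := by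
  intro A j f hj hf
  rw [mem_ideal_span_X_image] at hf ⊢
  intro m hm
  obtain ⟨i, hi, hne⟩ := hf (m + Finsupp.single j 1) (by
    rw [mem_support_iff, coeff_mul_X]; exact mem_support_iff.1 hm)
  have hij : j ≠ i := fun h => hj (h ▸ hi)
  refine ⟨i, hi, ?_⟩
  simpa [Finsupp.single_eq_of_ne' hij] using hne

theorem mem_span_algEquiv_image {σ ι : Type*} {L : ι → MvPolynomial σ k} (A : Set ι)
    (φ : MvPolynomial σ k ≃ₐ[k] MvPolynomial σ k) (f : MvPolynomial σ k) :
    f ∈ Ideal.span (φ ∘ L '' A) ↔ φ.symm f ∈ Ideal.span (L '' A) := by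
  have : Ideal.span (φ ∘ L '' A) = (Ideal.span (L '' A)).map (φ : _ ≃+* _) := by
    rw [Ideal.map_span, Set.image_comp]; rfl
  rw [this, Ideal.mem_map_of_equiv]
  constructor
  · rintro ⟨x, hx, rfl⟩
    simpa using hx
  · intro h
    exact ⟨_, h, by simp⟩

theorem IsRegularFamily.map {σ : Type*} {L : σ → MvPolynomial σ k} (hL : IsRegularFamily L)
    (φ : MvPolynomial σ k ≃ₐ[k] MvPolynomial σ k) : IsRegularFamily (φ ∘ L) := by
  intro A j f hj hf
  rw [mem_span_algEquiv_image] at hf ⊢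
  exact hL A j _ hj (by simpa using hf)

theorem LinearQuotients.map {σ τ ι : Type*} [Fintype ι] [LinearOrder ι] {L : τ → MvPolynomial σ k}
    {g : ι → MvPolynomial σ k} {S : ι → Finset τ} (h : LinearQuotients L g S)
    (φ : MvPolynomial σ k ≃ₐ[k] MvPolynomial σ k)
    (hφ : ∀ f d, f.IsHomogeneous d → (φ f).IsHomogeneous d) :
    LinearQuotients (φ ∘ L) (φ ∘ g) S where
  colon_le i f hf := by
    rw [mem_span_algEquiv_image]
    refine h.colon_le i _ ?_
    have := (mem_span_algEquiv_image _ φ _).1 hf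
    simpa using this
  exists_coeff i j hj := by
    obtain ⟨c, hc, hc0, hsum⟩ := h.exists_coeff i j hj
    refine ⟨φ ∘ c, fun l => hφ _ _ (hc l), fun l hl => by simp [hc0 l hl], ?_⟩
    simpa using congrArg φ hsum

/-- Monomials of one degree which satisfy the exchange property of polymatroids have linear
quotients in decreasing lexicographic order. -/
theorem exists_linearQuotients_monomial {σ : Type*} [Fintype σ] [LinearOrder σ] {d : ℕ}
    {A : Set (σ →₀ ℕ)} (hdeg : ∀ u ∈ A, u.degree = d)
    (hexch : ∀ u ∈ A, ∀ v ∈ A, ∀ i j, u i < v i → v j < u j →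
      u + Finsupp.single i 1 - Finsupp.single j 1 ∈ A) :
    ∃ (b : ℕ) (u : Fin b → σ →₀ ℕ) (S : Fin b → Finset σ), Set.range u = A ∧
      LinearQuotients (X : σ → MvPolynomial σ k) (fun l => monomial (u l) (1 : k)) S := by
  classical
  -- In the dual order, the predecessors of a monomial are the lexicographically larger ones.
  let ι := {u : (Lex (σ →₀ ℕ))ᵒᵈ // ofLex (OrderDual.ofDual u) ∈ A}
  let val : ι → σ →₀ ℕ := fun u => ofLex (OrderDual.ofDual u.1)
  have hfin : A.Finite := by
    refine (Set.finite_Iic (Finsupp.equivFunOnFinite.symm fun _ : σ => d)).subset fun u hu i => ?_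
    rw [← hdeg u hu]
    exact Finsupp.le_degree i u
  have : Finite ι := Set.finite_coe_iff.2 hfin
  have : Fintype ι := Fintype.ofFinite ι
  have hlt : ∀ u v : ι, v < u ↔ ∃ i, (∀ j < i, val u j = val v j) ∧ val u i < val v i :=
    fun u v => Finsupp.Lex.lt_iff
  let S : ι → Finset σ := fun u => {i | ∃ v : ι, v < u ∧ ∃ j,
    val v + Finsupp.single j 1 = val u + Finsupp.single i 1}
  have hlin : LinearQuotients (X : σ → MvPolynomial σ k) (fun u : ι => monomial (val u) (1 : k)) S := by
    refine ⟨fun u f hf => ?_, fun u i hi => ?_⟩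
    · have hf' : f * monomial (val u) 1 ∈
          Ideal.span ((fun s => monomial s (1 : k)) '' (val '' Set.Iio u)) := by
        rw [Set.image_image]; exact hf
      rw [mem_ideal_span_monomial_image] at hf'
      rw [mem_ideal_span_X_image]
      intro m hm
      obtain ⟨_, ⟨v, hv, rfl⟩, hle⟩ := hf' (m + val u) (by
        rw [mem_support_iff, coeff_mul_monomial, mul_one]; exact mem_support_iff.1 hm)
      obtain ⟨i, hi, hlt'⟩ := (hlt u v).1 hv
      have hsum : ∑ j, val v j = ∑ j, val u j := by
        rw [← Finsupp.degree_eq_sum, ← Finsupp.degree_eq_sum, hdeg _ v.2, hdeg _ u.2]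
      obtain ⟨j, -, hj⟩ : ∃ j ∈ Finset.univ, val v j < val u j := by
        by_contra! hcon
        exact absurd hsum (Finset.sum_lt_sum hcon ⟨i, Finset.mem_univ _, hlt'⟩).ne'
      have hij : i < j := by
        by_contra! hji
        rcases hji.lt_or_eq with h | rfl
        · exact absurd (hi j h) hj.ne'
        · exact lt_asymm hj hlt'
      -- As `i` is the first place where `u` and `v` differ and `i < j`, the exchange `u * x_i /
      -- x_j` precedes `u`; it puts `x_i` in the colon ideal, and `x_i` divides the monomial `m`.
      let w : ι := ⟨OrderDual.toDual (toLex (val u + Finsupp.single i 1 - Finsupp.single j 1)),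
        hexch _ u.2 _ v.2 i j hlt' hj⟩
      have hw : ∀ l, val w l = val u l + Finsupp.single i 1 l - Finsupp.single j 1 l := fun l => rfl
      refine ⟨i, ?_, ?_⟩
      · refine Finset.mem_coe.2 (Finset.mem_filter.2 ⟨Finset.mem_univ _, w, (hlt u w).2
          ⟨i, fun l hl => ?_, ?_⟩, j, ?_⟩)
        · rw [hw, Finsupp.single_eq_of_ne hl.ne, Finsupp.single_eq_of_ne (hl.trans hij).ne]
          simp
        · rw [hw, Finsupp.single_eq_same, Finsupp.single_eq_of_ne hij.ne]
          simp
        · ext l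
          rw [Finsupp.add_apply, hw, Finsupp.add_apply]
          refine Nat.sub_add_cancel ?_
          by_cases hl : l = j
          · subst hl; simp; omega
          · simp [Finsupp.single_eq_of_ne hl]
      · have := hle i
        simp only [Finsupp.add_apply] at this
        omega
    · obtain ⟨-, v, hv, j, hj⟩ := Finset.mem_filter.1 hi
      refine ⟨Pi.single v (X j), fun l => ?_, fun l hl => ?_, ?_⟩
      · by_cases hl : l = v
        · subst hl; simpa using isHomogeneous_X k j
        · simpa [hl] using isHomogeneous_zero σ k 1
      · simp [(hv.trans_le hl).ne']
      · rw [Finset.sum_eq_single v (fun l _ hl => by rw [Pi.single_eq_of_ne hl, zero_smul])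
          (fun h => absurd (Finset.mem_univ _) h), Pi.single_eq_same]
        simp only [smul_eq_mul, X, monomial_mul, mul_one]
        rw [add_comm _ (val u), add_comm _ (val v), hj]
  let e := Fintype.orderIsoFinOfCardEq ι rfl
  refine ⟨Fintype.card ι, val ∘ e, S ∘ e, ?_, hlin.comp_orderIso e⟩
  rw [e.surjective.range_comp]
  ext u
  exact ⟨fun ⟨v, hv⟩ => hv ▸ v.2, fun hu => ⟨⟨OrderDual.toDual (toLex u), hu⟩, rfl⟩⟩

/-- The degree of `m` in the variables other than `x_j` is `m.degree - m j`; the bound is stated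
additively to avoid truncated subtraction. -/
theorem mem_span_X_compl_singleton_pow {σ : Type*} [Fintype σ] (j : σ) (a : ℕ)
    (f : MvPolynomial σ k) :
    f ∈ Ideal.span ((X : σ → MvPolynomial σ k) '' {j}ᶜ) ^ a ↔
      ∀ m ∈ f.support, a + m j ≤ m.degree := by
  classical
  have key : Ideal.span ((X : σ → MvPolynomial σ k) '' {j}ᶜ) ^ a =
      Ideal.span ((fun s => monomial s (1 : k)) '' {m | a + m j ≤ m.degree}) := by
    induction a with
    | zero =>
      symm
      rw [pow_zero, Ideal.one_eq_top, Ideal.eq_top_iff_one]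
      exact Ideal.subset_span ⟨0, by simp, rfl⟩
    | succ a ih =>
      rw [pow_succ, ih, Ideal.span_mul_span']
      apply le_antisymm
      · refine Ideal.span_mono ?_
        rintro _ ⟨_, ⟨m, hm, rfl⟩, _, ⟨i, hi, rfl⟩, rfl⟩
        refine ⟨m + Finsupp.single i 1, ?_, by simp [X, monomial_mul]⟩
        have hi' : i ≠ j := hi
        simp only [Set.mem_ofPred_eq] at hm
        simp only [Set.mem_ofPred_eq, Finsupp.add_apply, map_add, Finsupp.degree_single,
          Finsupp.single_eq_of_ne' hi']
        omega
      · rw [Ideal.span_le]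
        rintro _ ⟨m, hm, rfl⟩
        simp only [Set.mem_ofPred_eq] at hm
        obtain ⟨i, hij, hi⟩ : ∃ i, i ≠ j ∧ m i ≠ 0 := by
          by_contra! hcon
          rw [Finsupp.degree_eq_sum, Finset.sum_eq_single j (fun i _ hi => hcon i hi)
            (fun h => absurd (Finset.mem_univ _) h)] at hm
          omega
        have hle : Finsupp.single i 1 ≤ m := by
          rw [Finsupp.single_le_iff]; omega
        have hm' : m = m - Finsupp.single i 1 + Finsupp.single i 1 := (tsub_add_cancel_of_le hle).symm
        refine Ideal.subset_span ⟨_, ⟨m - Finsupp.single i 1, ?_, rfl⟩, _, ⟨i, hij, rfl⟩, ?_⟩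
        · have h1 := congrArg Finsupp.degree hm'
          have h2 := DFunLike.congr_fun hm' j
          simp only [map_add, Finsupp.degree_single, Finsupp.add_apply,
            Finsupp.single_eq_of_ne' hij] at h1 h2
          simp only [Set.mem_ofPred_eq]
          omega
        · simp only [X, monomial_mul, mul_one]
          rw [← hm']
  rw [key, mem_ideal_span_monomial_image]
  refine forall₂_congr fun m _ => ⟨?_, fun h => ⟨m, h, le_rfl⟩⟩
  rintro ⟨s, hs, hle⟩
  obtain ⟨t, rfl⟩ := exists_add_of_le hle
  have := Finsupp.le_degree j t
  simp only [Set.mem_ofPred_eq] at hs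
  simp only [Finsupp.add_apply, map_add]
  omega

end Monomial

/-! ### Change of coordinates and ideals of points -/

section Coordinates

variable {k : Type*} [Field k] {n : ℕ}

/-- The linear change of coordinates which takes the standard basis to a given basis. -/
theorem exists_algEquiv_of_basis {σ : Type*} [Fintype σ] [DecidableEq σ]
    (v : Module.Basis σ k (σ → k)) :
    ∃ φ : MvPolynomial σ k ≃ₐ[k] MvPolynomial σ k,
      (∀ f d, f.IsHomogeneous d → (φ f).IsHomogeneous d) ∧
      (∀ f d, f.IsHomogeneous d → (φ.symm f).IsHomogeneous d) ∧
      ∀ f j c, eval (c • v j) (φ f) = eval (Pi.single j c) f := by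
  -- `L j` is the `j`-th coordinate functional of the basis `v`; `L' i` is the `i`-th entry of `∑
  -- x_j v_j`.
  let L : σ → MvPolynomial σ k := fun j => ∑ i, C (v.repr (Pi.single i 1) j) * X i
  let L' : σ → MvPolynomial σ k := fun i => ∑ j, C (v j i) * X j
  have hL : ∀ j, (L j).IsHomogeneous 1 := fun j =>
    IsHomogeneous.sum _ _ _ fun i _ => isHomogeneous_C_mul_X _ _
  have hL' : ∀ j, (L' j).IsHomogeneous 1 := fun j =>
    IsHomogeneous.sum _ _ _ fun i _ => isHomogeneous_C_mul_X _ _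
  have hrepr : ∀ w : σ → k, ∀ j, ∑ i, v.repr (Pi.single i 1) j * w i = v.repr w j := by
    intro w j
    conv_rhs => rw [← Finset.univ_sum_single w]
    rw [map_sum, Finsupp.finsetSum_apply]
    refine Finset.sum_congr rfl fun i _ => ?_
    rw [show (Pi.single i (w i) : σ → k) = w i • Pi.single i 1 by
      rw [← Pi.single_smul, smul_eq_mul, mul_one], map_smul, Finsupp.smul_apply, smul_eq_mul,
      mul_comm]
  have h1 : (aeval L).comp (aeval L') = AlgHom.id k (MvPolynomial σ k) := by
    refine algHom_ext fun i => ?_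
    have key : ∀ l, ∑ j, v j i * v.repr (Pi.single l 1) j = (Pi.single l 1 : σ → k) i := by
      intro l
      conv_rhs => rw [← v.sum_repr (Pi.single l 1)]
      simp [Finset.sum_apply, mul_comm]
    simp only [AlgHom.comp_apply, aeval_X, L', L, map_sum, map_mul, algHom_C, AlgHom.id_apply,
      Finset.mul_sum, algebraMap_eq]
    rw [Finset.sum_comm]
    simp only [← mul_assoc, ← C_mul, ← Finset.sum_mul, ← map_sum, key]
    rw [Finset.sum_eq_single i (fun l _ hl => by rw [Pi.single_eq_of_ne' hl]; simp)
      (fun h => absurd (Finset.mem_univ _) h)]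
    simp
  have h2 : (aeval L').comp (aeval L) = AlgHom.id k (MvPolynomial σ k) := by
    refine algHom_ext fun j => ?_
    have key : ∀ l, ∑ i, v.repr (Pi.single i 1) j * v l i = if l = j then 1 else 0 := by
      intro l
      rw [hrepr, v.repr_self, Finsupp.single_apply]
    simp only [AlgHom.comp_apply, aeval_X, L', L, map_sum, map_mul, algHom_C, AlgHom.id_apply,
      Finset.mul_sum, algebraMap_eq]
    rw [Finset.sum_comm]
    simp only [← mul_assoc, ← C_mul, ← Finset.sum_mul, ← map_sum, key]
    simp
  refine ⟨AlgEquiv.ofAlgHom (aeval L) (aeval L') h1 h2, fun f d hf => ?_, fun f d hf => ?_,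
    fun f j c => ?_⟩
  · simpa using hf.aeval L hL
  · simpa using hf.aeval L' hL'
  · have hhom : ((aeval (c • v j)).comp (aeval L) : MvPolynomial σ k →ₐ[k] k) =
        aeval (Pi.single j c) := by
      refine algHom_ext fun i => ?_
      simp only [AlgHom.comp_apply, aeval_X, L, map_sum, map_mul, algHom_C, Algebra.algebraMap_self,
        RingHom.id_apply]
      rw [hrepr, map_smul, v.repr_self, Finsupp.smul_single, smul_eq_mul, mul_one,
        Finsupp.single_eq_pi_single]
    exact DFunLike.congr_fun hhom f

/-- The value of a form of degree `d` at the `j`-th coordinate vector is its coefficient of `x_j ^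
d`, over any field. -/
theorem mem_span_X_compl_singleton_of_eval_eq_zero {σ : Type*} [Fintype σ] [DecidableEq σ] {j : σ}
    {d : ℕ} {f : MvPolynomial σ k} (hf : f.IsHomogeneous d)
    (h0 : eval (Pi.single j 1) f = 0) : f ∈ Ideal.span ((X : σ → MvPolynomial σ k) '' {j}ᶜ) := by
  rw [mem_ideal_span_X_image]
  intro m hm
  by_contra! hcon
  have hsingle : ∀ m' ∈ f.support, (∀ i, i ≠ j → m' i = 0) → m' = Finsupp.single j d := by
    intro m' hm' hz
    have hdeg : m'.degree = d := by
      by_contra h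
      exact mem_support_iff.1 hm' (hf.coeff_eq_zero h)
    rw [Finsupp.degree_eq_sum, Finset.sum_eq_single j (fun i _ hi => hz i hi)
      (fun h => absurd (Finset.mem_univ _) h)] at hdeg
    ext i
    by_cases hi : i = j
    · subst hi; simpa using hdeg
    · rw [hz i hi, Finsupp.single_eq_of_ne hi]
  have hmj := hsingle m hm hcon
  rw [eval_eq', Finset.sum_eq_single m ?_ (fun h => absurd hm h)] at h0
  · refine mem_support_iff.1 hm ?_
    rw [Finset.prod_eq_one, mul_one] at h0
    · exact h0
    · intro i _
      by_cases hi : i = j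
      · subst hi; simp
      · rw [hcon i hi, pow_zero]
  · intro m' hm' hne
    obtain ⟨i, hi, hne'⟩ : ∃ i, i ≠ j ∧ m' i ≠ 0 := by
      by_contra! hz
      exact hne ((hsingle m' hm' hz).trans hmj.symm)
    rw [Finset.prod_eq_zero (Finset.mem_univ i), mul_zero]
    rw [Pi.single_eq_of_ne hi, zero_pow hne']

theorem pointIdeal_eq_map {P : Projectivization k (Fin (n + 1) → k)}
    {v : Module.Basis (Fin (n + 1)) k (Fin (n + 1) → k)} {j : Fin (n + 1)} (hPj : v j = P.rep)
    {φ : MvPolynomial (Fin (n + 1)) k ≃ₐ[k] MvPolynomial (Fin (n + 1)) k}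
    (hφ : ∀ f d, f.IsHomogeneous d → (φ f).IsHomogeneous d)
    (hφ' : ∀ f d, f.IsHomogeneous d → (φ.symm f).IsHomogeneous d)
    (heval : ∀ f j c, eval (c • v j) (φ f) = eval (Pi.single j c) f) :
    pointIdeal P = (Ideal.span ((X : Fin (n + 1) → MvPolynomial (Fin (n + 1)) k) '' {j}ᶜ)).map
      (φ : _ ≃+* _) := by
  apply le_antisymm
  · refine Ideal.span_le.2 ?_
    rintro f ⟨d, hf, h0⟩
    refine (Ideal.mem_map_of_equiv _ _).2 ⟨φ.symm f, ?_, by simp⟩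
    refine mem_span_X_compl_singleton_of_eval_eq_zero (hφ' f d hf) ?_
    rw [← heval, one_smul, AlgEquiv.apply_symm_apply, hPj]
    exact h0 _ (by rw [Projectivization.submodule_eq]; exact Submodule.mem_span_singleton_self _)
  · rw [Ideal.map_span, Ideal.span_le]
    rintro _ ⟨_, ⟨i, hi, rfl⟩, rfl⟩
    refine Ideal.subset_span ⟨1, hφ _ _ (isHomogeneous_X k i), fun w hw => ?_⟩
    rw [Projectivization.submodule_eq, Submodule.mem_span_singleton, ← hPj] at hw
    obtain ⟨c, rfl⟩ := hw
    refine (heval _ _ _).trans ?_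
    rw [eval_X, Pi.single_eq_of_ne hi]

theorem exists_basis_rep {r : ℕ} {P : Fin (r + 1) → Projectivization k (Fin (n + 1) → k)}
    (hP : Projectivization.Independent P) :
    ∃ (v : Module.Basis (Fin (n + 1)) k (Fin (n + 1) → k)) (τ : Fin (r + 1) → Fin (n + 1)),
      ∀ i, v (τ i) = (P i).rep := by
  have hli := Projectivization.independent_iff.1 hP
  let b := Module.Basis.sumExtend hli
  let e := b.indexEquiv (Pi.basisFun k (Fin (n + 1)))
  refine ⟨b.reindex e, fun i => e (Sum.inl i), fun i => ?_⟩
  rw [Module.Basis.reindex_apply, Equiv.symm_apply_apply]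
  simp only [b, Module.Basis.sumExtend, Module.Basis.reindex_apply, Module.Basis.extend_apply_self]
  rfl

theorem mem_fatPointIdeal_iff {r : ℕ} {P : Fin (r + 1) → Projectivization k (Fin (n + 1) → k)}
    {v : Module.Basis (Fin (n + 1)) k (Fin (n + 1) → k)} {τ : Fin (r + 1) → Fin (n + 1)}
    (hτ : ∀ i, v (τ i) = (P i).rep)
    {φ : MvPolynomial (Fin (n + 1)) k ≃ₐ[k] MvPolynomial (Fin (n + 1)) k}
    (hφ : ∀ f d, f.IsHomogeneous d → (φ f).IsHomogeneous d)
    (hφ' : ∀ f d, f.IsHomogeneous d → (φ.symm f).IsHomogeneous d)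
    (heval : ∀ f j c, eval (c • v j) (φ f) = eval (Pi.single j c) f)
    (a : Fin (r + 1) → ℕ) (f : MvPolynomial (Fin (n + 1)) k) :
    φ f ∈ fatPointIdeal P a ↔ ∀ m ∈ f.support, ∀ i, a i + m (τ i) ≤ m.degree := by
  have key : ∀ i, φ f ∈ pointIdeal (P i) ^ a i ↔ ∀ m ∈ f.support, a i + m (τ i) ≤ m.degree := by
    intro i
    rw [pointIdeal_eq_map (hτ i) hφ hφ' heval, ← Ideal.map_pow, Ideal.mem_map_of_equiv,
      ← mem_span_X_compl_singleton_pow]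
    constructor
    · rintro ⟨g, hg, hgf⟩
      rwa [← φ.injective hgf]
    · exact fun h => ⟨f, h, rfl⟩
  simp only [fatPointIdeal, Ideal.mem_iInf, key]
  exact ⟨fun h m hm i => h i m hm, fun h i m hm => h m hm i⟩

theorem isHomogeneous_fatPointIdeal {r : ℕ}
    (P : Fin (r + 1) → Projectivization k (Fin (n + 1) → k)) (a : Fin (r + 1) → ℕ) :
    (fatPointIdeal P a).IsHomogeneous (homogeneousSubmodule (Fin (n + 1)) k) := by
  refine Ideal.IsHomogeneous.iInf fun i => ?_
  have h : (pointIdeal (P i)).IsHomogeneous (homogeneousSubmodule (Fin (n + 1)) k) :=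
    Ideal.homogeneous_span _ _ fun f ⟨d, hf, _⟩ => ⟨d, hf⟩
  generalize a i = m
  induction m with
  | zero => rw [pow_zero, Ideal.one_eq_top]; exact Ideal.IsHomogeneous.top _
  | succ m ih => rw [pow_succ]; exact ih.mul h

end Coordinates

end FatPoint

/-! ### Assembly: bounded exponents -/

theorem theorem4p5 {k : Type*} [Field k] (n r : ℕ) (hr : r ≤ n)
    (P : Fin (r + 1) → Projectivization k (Fin (n + 1) → k))
    (hP : Projectivization.Independent P) (a : Fin (r + 1) → ℕ) :
    FatPoint.IsComponentwiseLinear (FatPoint.fatPointIdeal P a) := by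
  open FatPoint MvPolynomial in
  refine ⟨isHomogeneous_fatPointIdeal P a, fun d => ?_⟩
  obtain ⟨v, τ, hτ⟩ := exists_basis_rep hP
  obtain ⟨φ, hφ, hφ', heval⟩ := exists_algEquiv_of_basis v
  have hmem := mem_fatPointIdeal_iff hτ hφ hφ' heval a
  -- The bounds are `m (τ i) ≤ d - a i`; `A` is empty if some `a i > d`.
  let A : Set (Fin (n + 1) →₀ ℕ) := {m | m.degree = d ∧ ∀ i, a i + m (τ i) ≤ d}
  obtain ⟨b, u, S, hu, hlin⟩ := exists_linearQuotients_monomial (k := k) (d := d) (A := A)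
    (fun m hm => hm.1) (by
      intro u hu w hw i j hi hj
      have hle : Finsupp.single j 1 ≤ u + Finsupp.single i 1 := by
        rw [Finsupp.single_le_iff, Finsupp.add_apply]; omega
      refine ⟨?_, fun l => ?_⟩
      · have h := congrArg Finsupp.degree (tsub_add_cancel_of_le hle)
        simp only [map_add, Finsupp.degree_single, hu.1] at h
        omega
      · have h1 := hu.2 l
        have h2 := hw.2 l
        simp only [Finsupp.tsub_apply, Finsupp.add_apply]
        by_cases hl : τ l = i
        -- Only the exponent at `i` grows, to at most `w i`, which obeys the same bound.
        · rw [hl] at h1 h2 ⊢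
          rw [Finsupp.single_eq_same]
          omega
        · rw [Finsupp.single_eq_of_ne hl]
          omega)
  have hAhom : ∀ l, (monomial (u l) (1 : k)).IsHomogeneous d := fun l =>
    isHomogeneous_monomial _ (show u l ∈ A from hu ▸ Set.mem_range_self l).1
  have hspan : degreePart (fatPointIdeal P a) d =
      Ideal.span (Set.range (φ ∘ fun l => monomial (u l) (1 : k))) := by
    apply le_antisymm
    · refine Ideal.span_le.2 ?_
      rintro f ⟨hfJ, hf⟩
      rw [← φ.apply_symm_apply f, hmem] at hfJ
      rw [← Set.image_univ, SetLike.mem_coe, mem_span_algEquiv_image,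
        (φ.symm f).as_sum]
      refine Ideal.sum_mem _ fun m hm => ?_
      have hdeg : m.degree = d := by
        by_contra h
        exact mem_support_iff.1 hm ((hφ' f d hf).coeff_eq_zero h)
      obtain ⟨l, rfl⟩ : m ∈ Set.range u := by
        rw [hu]; exact ⟨hdeg, fun i => (hfJ m hm i).trans hdeg.le⟩
      rw [← mul_one (coeff _ _), ← C_mul_monomial]
      exact Ideal.mul_mem_left _ _ (Ideal.subset_span ⟨l, Set.mem_univ _, rfl⟩)
    · refine Ideal.span_le.2 ?_
      rintro _ ⟨l, rfl⟩
      refine Ideal.subset_span ⟨(hmem _).2 fun m hm i => ?_, hφ _ _ (hAhom l)⟩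
      have hl : u l ∈ A := hu ▸ Set.mem_range_self l
      obtain rfl : m = u l := by simpa using support_monomial_subset hm
      rw [hl.1]
      exact hl.2 i
  rw [hspan]
  exact (hlin.map φ hφ).hasLinearResolution (fun j => hφ _ _ (isHomogeneous_X k j))
    (isRegularFamily_X.map φ) fun l => hφ _ _ (hAhom l)
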